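/- Let $\beta\in(0,1]$, $L>0$, $C\ge 1$ and $\alpha>0$. Let $\mathcal F(\beta,L)$ be the set of functions $f:[0,1]\to\mathbb R$ with $f(0)=0$ and $|f(x)-f(x')|\le L|x-x'|^\beta$ for all $x,x'\in[0,1]$. For Borel probability measures $P,Q$ on $[0,1]$ and $h>0$ put $\rho_h(P,Q)=\int_0^1 \frac{1}{P(B(x,h))}\,dQ(x)$, where $B(x,h)=\{x'\in[0,1]:|x-x'|\le h\}$ and $1/0=\infty$, and let $$\mathcal D(\alpha,C)=\Big\{(P,Q):\sup_{0<h\le1}h^\alpha\rho_h(P,Q)\le C\Big\},\qquad \mathcal D'(\alpha,C)=\Big\{(P,Q)\in\mathcal D(\alpha,C):\sup_{0<h\le1}\rho_h(Q,Q)\le C\Big\}.$$ One observes $n=n_P+n_Q$ independent pairs $(X_i,Y_i)$ with $Y_i=f^\star(X_i)+\xi_i$, where $X_i\sim P$ for $i\le n_P$ and $X_i\sim Q$ for $n_P<i\le n$, and where, for every $x$, the conditional law of $\xi_i$ given $X_i=x$ is the same for all $i$, is centered, and has second moment at most $\sigma^2$. The minimax risk $$\mathfrak M(P,Q)=\inf_{\hat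 f}\ \sup_{f^\star\in\mathcal F(\beta,L)}\ \mathbb E\,\|\hat f-f^\star\|_{L^2(Q)}^2$$ is over all estimators $\hat f$ (measurable functions of the data, which may depend on $P,Q$), the supremum being also over all noise laws of this kind. Then there is a constant $c>0$ depending only on $(\beta,L,\alpha,C)$ (not on $n_P,n_Q,\sigma$), and for every $\sigma>0$ an integer $n_\ell=n_\ell(\sigma,L,C,\alpha,\beta)$, such that for all sample sizes $n_P,n_Q\ge0$ with $\max\{n_P,n_Q\}\ge n_\ell$: (a) if $\alpha>1$, there is a pair $(P,Q)\in\mathcal D(\alpha,C)$ with $$\mathfrak M(P,Q)\ \ge\ c\Big\{\Big(\frac{n_P}{\sigma^2}\Big)^{\frac{2\beta+1}{2\beta+\alpha}}+\frac{n_Q}{\sigma^2}\Big\}^{-\frac{2\beta}{2\beta+1}};$$ (b) if $0<\alpha\le1$, there is a pair $(P,Q)\in\mathcal D'(\alpha,C)$ with $$\mathfrak M(P,Q)\ \ge\ c\Big\{\Big(\frac{n_P}{\sigma^2}\Big)^{\frac{2\beta}{2\beta+\alpha}}+\frac{n_Q}{\sigma^2}\Big\}^{-1}.$$ In both cases, for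 the same pair $(P,Q)$ and the same $c$, the bound holds already when the noise is known to be $\mathcal N(0,\sigma^2)$, independent of the covariates, that is, when the supremum is over $f^\star\in\mathcal F(\beta,L)$ only. -/

import Mathlib

open MeasureTheory ProbabilityTheory
open scoped ENNReal NNReal

noncomputable section

namespace CovariateShift

/-- The Hölder class `F(β, L)` on `[0,1]`: functions with
`|f x - f x'| ≤ L |x - x'| ^ β` for all `x, x'`, and `f 0 = 0`. -/
def holderClass (β L : ℝ) : Set (unitInterval → ℝ) :=
  {f | (∀ x x' : unitInterval, |f x - f x'| ≤ L * |(x : ℝ) - (x' : ℝ)| ^ β) ∧ f 0 = 0}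

/-- The similarity measure `ρ_h(P, Q) = ∫ 1 / P(B(x, h)) dQ(x)`, with closed balls and values
in `[0, ∞]` (so that `1 / 0 = ∞`). -/
def similarity (h : ℝ) (P Q : Measure unitInterval) : ℝ≥0∞ :=
  ∫⁻ x, (P (Metric.closedBall x h))⁻¹ ∂Q

/-- The family `D(α, C)`: pairs with `sup_{0 < h ≤ 1} h ^ α ρ_h(P, Q) ≤ C`. -/
def alphaFamily (α C : ℝ) :
    Set (ProbabilityMeasure unitInterval × ProbabilityMeasure unitInterval) :=
  {PQ | (⨆ h ∈ Set.Ioc (0 : ℝ) 1,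
      ENNReal.ofReal (h ^ α) * similarity h (PQ.1 : Measure unitInterval) PQ.2)
        ≤ ENNReal.ofReal C}

/-- The restricted family `D'(α, C)`: pairs in `D(α, C)` for which moreover
`sup_{0 < h ≤ 1} ρ_h(Q, Q) ≤ C`. -/
def restrictedAlphaFamily (α C : ℝ) :
    Set (ProbabilityMeasure unitInterval × ProbabilityMeasure unitInterval) :=
  {PQ | (⨆ h ∈ Set.Ioc (0 : ℝ) 1,
      ENNReal.ofReal (h ^ α) * similarity h (PQ.1 : Measure unitInterval) PQ.2)
        ≤ ENNReal.ofReal C ∧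
    (⨆ h ∈ Set.Ioc (0 : ℝ) 1, similarity h (PQ.2 : Measure unitInterval) PQ.2)
        ≤ ENNReal.ofReal C}

/-- Noise models: `ν x` is the conditional law of the noise `ξ` given `X = x`. It is a
probability measure, centered, with second moment at most `σ ^ 2`. (Integrability of `ξ` under
`ν x` follows from the finite second moment.) -/
def noiseClass (σ : ℝ) : Set (Kernel unitInterval ℝ) :=
  {ν | IsMarkovKernel ν ∧
    ∀ x, ∫ ξ, ξ ∂(ν x) = 0 ∧ ∫⁻ ξ, ‖ξ‖ₑ ^ 2 ∂(ν x) ≤ ENNReal.ofReal (σ ^ 2)}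

/-- The noise `ξ ~ N(0, σ ^ 2)`, independent of the covariate. -/
def gaussianNoise (σ : ℝ) : Kernel unitInterval ℝ :=
  Kernel.const unitInterval (gaussianReal 0 (σ ^ 2).toNNReal)

/-- The law of one observation `(X, Y)`, where `X ~ μ`, `Y = f X + ξ` and `ξ | X = x ~ ν x`. -/
def observationLaw (μ : Measure unitInterval) (f : unitInterval → ℝ)
    (ν : Kernel unitInterval ℝ) : Measure (unitInterval × ℝ) :=
  (μ ⊗ₘ ν).map (fun p => (p.1, f p.1 + p.2))

/-- Data sets: `nP` source observations and `nQ` target observations. -/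
abbrev Data (nP nQ : ℕ) : Type :=
  (Fin nP → unitInterval × ℝ) × (Fin nQ → unitInterval × ℝ)

/-- The law of the data: independent observations, with covariates from `P` in the first sample
and from `Q` in the second one. -/
def dataLaw (nP nQ : ℕ) (P Q : Measure unitInterval) (f : unitInterval → ℝ)
    (ν : Kernel unitInterval ℝ) : Measure (Data nP nQ) :=
  (Measure.pi fun _ : Fin nP => observationLaw P f ν).prod
    (Measure.pi fun _ : Fin nQ => observationLaw Q f ν)

/-- Estimators: maps from data sets to functions on `[0,1]`, jointly measurable in the data and
the point of evaluation. -/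
def estimators (nP nQ : ℕ) : Set (Data nP nQ → unitInterval → ℝ) :=
  {fhat | Measurable (Function.uncurry fhat)}

/-- The mean-squared error `E ‖fhat - f‖²_{L²(Q)}`, with values in `[0, ∞]`. -/
def risk {nP nQ : ℕ} (P Q : Measure unitInterval) (f : unitInterval → ℝ)
    (ν : Kernel unitInterval ℝ) (fhat : Data nP nQ → unitInterval → ℝ) : ℝ≥0∞ :=
  ∫⁻ D, (∫⁻ x, ‖fhat D x - f x‖ₑ ^ 2 ∂Q) ∂(dataLaw nP nQ P Q f ν)

/-- The minimax risk over the Hölder class `F(β, L)` and a set `N` of noise models. -/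
def minimaxRisk (nP nQ : ℕ) (P Q : Measure unitInterval) (β L : ℝ)
    (N : Set (Kernel unitInterval ℝ)) : ℝ≥0∞ :=
  ⨅ fhat ∈ estimators nP nQ, ⨆ f ∈ holderClass β L, ⨆ ν ∈ N, risk P Q f ν fhat

end CovariateShift

end

namespace CovariateShift

/-! The bound is Assouad's method run on discrete covariate laws. Split an initial piece of [0,1]
into M cells of length 2r. A vector of bits selects which cell midpoints carry a bump of height Δ =
L r^β, while all left end points have value 0. The target Q is uniform on the midpoints, so each
wrong bit costs Δ²/M in L²(Q). The source P puts only mass p on the midpoints and the rest on the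
left end points, where the regression function is always 0 and nothing is learned.

Flipping one bit changes the law of the data only through observations at one midpoint. The
chi-square divergence factorizes over the sample and stays bounded as long as (Δ²/σ²)(nP p/M + nQ/M)
is small. No estimator then recovers the bits, and the risk is at least Δ²/8
(`le_minimaxRisk_cellLaw`).

Membership in the family requires P(B(x,h)) ≥ h^α at the atoms x of Q. For small h only the midpoint
itself counts, so p/M = r^α is taken. If α > 1, about 1/r cells are affordable, since the left end
points give a ball of radius h mass of order h ≥ h^α; this makes the target information per cell of
order nQ r. If α ≤ 1, a single cell is used, Q is a point mass, and the information is nP r^α + nQ.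
The largest admissible r gives the two rates (`exists_bandwidth`). -/

/-! ### Chi-square bounds, their tensorization, and the two-point inequality -/

/-- `ν` has a density with respect to `μ` whose second moment under `μ` is at most `K`. -/
def HasSqDensityLE {Ω : Type*} [MeasurableSpace Ω] (μ ν : Measure Ω) (K : ℝ≥0∞) : Prop :=
  ∃ l : Ω → ℝ≥0∞, Measurable l ∧ ν = μ.withDensity l ∧ ∫⁻ x, l x ^ 2 ∂μ ≤ K

theorem lintegral_pi_prod {ι Ω : Type*} [Fintype ι] [MeasurableSpace Ω] (μ : Measure Ω)
    [IsProbabilityMeasure μ] (g : ι → Ω → ℝ≥0∞) (hg : ∀ i, Measurable (g i)) :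
    ∫⁻ x, ∏ i, g i (x i) ∂(Measure.pi fun _ : ι => μ) = ∏ i, ∫⁻ x, g i x ∂μ := by
  have hind : iIndepFun (fun i (x : ι → Ω) => g i (x i)) (Measure.pi fun _ : ι => μ) :=
    iIndepFun_pi fun i => (hg i).aemeasurable
  have h := lintegral_prod_eq_prod_lintegral_of_indepFun Finset.univ _ hind
    (fun i => (hg i).comp (measurable_pi_apply i))
  rw [h]
  refine Finset.prod_congr rfl fun i _ => ?_
  exact (measurePreserving_eval (fun _ : ι => μ) i).lintegral_comp (hg i)

theorem HasSqDensityLE.pi {ι Ω : Type*} [Fintype ι] [MeasurableSpace Ω] {μ ν : Measure Ω}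
    [IsProbabilityMeasure μ] [IsProbabilityMeasure ν] {K : ℝ≥0∞} (h : HasSqDensityLE μ ν K) :
    HasSqDensityLE (Measure.pi fun _ : ι => μ) (Measure.pi fun _ : ι => ν)
      (K ^ Fintype.card ι) := by
  obtain ⟨l, hl, hν, hK⟩ := h
  refine ⟨fun x => ∏ i, l (x i), by fun_prop, ?_, ?_⟩
  · refine Measure.pi_eq fun s hs => ?_
    rw [withDensity_apply _ (MeasurableSet.univ_pi hs),
      ← lintegral_indicator (MeasurableSet.univ_pi hs)]
    have : ∀ x : ι → Ω, (Set.univ.pi s).indicator (fun x => ∏ i, l (x i)) x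
        = ∏ i, (s i).indicator l (x i) := by
      intro x
      by_cases hx : x ∈ Set.univ.pi s
      · rw [Set.indicator_of_mem hx]
        exact Finset.prod_congr rfl fun i _ =>
          (Set.indicator_of_mem (hx i (Set.mem_univ i)) _).symm
      · rw [Set.indicator_of_notMem hx]
        simp only [Set.mem_univ_pi, not_forall] at hx
        obtain ⟨i, hi⟩ := hx
        exact (Finset.prod_eq_zero (Finset.mem_univ i) (Set.indicator_of_notMem hi _)).symm
    simp_rw [this]
    rw [lintegral_pi_prod _ _ fun i => hl.indicator (hs i)]
    refine Finset.prod_congr rfl fun i _ => ?_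
    rw [lintegral_indicator (hs i), hν, withDensity_apply _ (hs i)]
  · simp_rw [← Finset.prod_pow]
    rw [lintegral_pi_prod μ (fun _ x => l x ^ 2) fun i => hl.pow_const 2, Finset.prod_const,
      Finset.card_univ]
    gcongr

theorem HasSqDensityLE.prod {Ω Ω' : Type*} [MeasurableSpace Ω] [MeasurableSpace Ω']
    {μ ν : Measure Ω} {μ' ν' : Measure Ω'} [SFinite μ] [SFinite ν] [SFinite μ'] [SFinite ν']
    {K K' : ℝ≥0∞} (h : HasSqDensityLE μ ν K) (h' : HasSqDensityLE μ' ν' K') :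
    HasSqDensityLE (μ.prod μ') (ν.prod ν') (K * K') := by
  obtain ⟨l, hl, hν, hK⟩ := h
  obtain ⟨l', hl', hν', hK'⟩ := h'
  subst hν hν'
  refine ⟨fun x => l x.1 * l' x.2, by fun_prop, prod_withDensity hl hl', ?_⟩
  simp_rw [mul_pow]
  rw [lintegral_prod_mul (hl.pow_const 2).aemeasurable (hl'.pow_const 2).aemeasurable]
  gcongr

/-- Minimizing over `a` gives (a - u₀)² + l (a - u₁)² ≥ (u₁ - u₀)² l/(1 + l). The concave-looking
factor is then made integrable by the tangent to 1/s at s = 4, that is 1/(1 + l) ≥ 1/2 - (1 + l)/16.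
The tangency point l = 3 matches the second-moment bound 3 used in `HasSqDensityLE.two_point`. -/
theorem two_point_pointwise (l : ℝ≥0∞) (a u₀ u₁ : ℝ) :
    ENNReal.ofReal ((u₁ - u₀) ^ 2 / 2) * l ≤ ‖a - u₀‖ₑ ^ 2 + l * ‖a - u₁‖ₑ ^ 2
      + ENNReal.ofReal ((u₁ - u₀) ^ 2 / 16) * (l + l ^ 2) := by
  rcases eq_or_ne u₁ u₀ with rfl | hne
  · simp
  have hpos : 0 < (u₁ - u₀) ^ 2 := by have := sub_ne_zero.2 hne; positivity
  rcases eq_or_ne l ∞ with rfl | hl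
  · have : ENNReal.ofReal ((u₁ - u₀) ^ 2 / 16) ≠ 0 := by
      rw [ne_eq, ENNReal.ofReal_eq_zero, not_le]; positivity
    simp [ENNReal.mul_top this]
  · obtain ⟨t, ht, rfl⟩ : ∃ t : ℝ, 0 ≤ t ∧ l = ENNReal.ofReal t :=
      ⟨l.toReal, ENNReal.toReal_nonneg, (ENNReal.ofReal_toReal hl).symm⟩
    have e : ∀ b : ℝ, ‖b‖ₑ ^ 2 = ENNReal.ofReal (b ^ 2) := fun b => by
      rw [Real.enorm_eq_ofReal_abs, ← ENNReal.ofReal_pow (abs_nonneg b), sq_abs]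
    rw [e, e, ← ENNReal.ofReal_pow ht, ← ENNReal.ofReal_mul ht, ← ENNReal.ofReal_add ht (by positivity),
      ← ENNReal.ofReal_mul (by positivity), ← ENNReal.ofReal_mul (by positivity),
      ← ENNReal.ofReal_add (by positivity) (by positivity),
      ← ENNReal.ofReal_add (by positivity) (by positivity)]
    apply ENNReal.ofReal_le_ofReal
    have h1 : (u₁ - u₀) ^ 2 * t ≤ ((a - u₀) ^ 2 + t * (a - u₁) ^ 2) * (1 + t) := by
      nlinarith [sq_nonneg ((a - u₀) + t * (a - u₁))]
    have h2 : 0 ≤ (a - u₀) ^ 2 + t * (a - u₁) ^ 2 := by positivity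
    have h3 : (u₁ - u₀) ^ 2 * t / (1 + t) ≤ (a - u₀) ^ 2 + t * (a - u₁) ^ 2 := by
      rw [div_le_iff₀ (by positivity)]; exact h1
    have h4 : (u₁ - u₀) ^ 2 / 2 * t - (u₁ - u₀) ^ 2 / 16 * (t + t ^ 2)
        ≤ (u₁ - u₀) ^ 2 * t / (1 + t) := by
      rw [le_div_iff₀ (by positivity)]
      have : 0 ≤ (u₁ - u₀) ^ 2 * t * (3 - t) ^ 2 := by positivity
      nlinarith
    linarith

/-- Le Cam's two-point bound for the squared error, in terms of the chi-square divergence. -/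
theorem HasSqDensityLE.two_point {Ω : Type*} [MeasurableSpace Ω] {μ ν : Measure Ω}
    [IsProbabilityMeasure μ] [IsProbabilityMeasure ν] (h : HasSqDensityLE μ ν 3)
    {a : Ω → ℝ} (ha : Measurable a) (u₀ u₁ : ℝ) :
    ENNReal.ofReal ((u₁ - u₀) ^ 2 / 4)
      ≤ ∫⁻ x, ‖a x - u₀‖ₑ ^ 2 ∂μ + ∫⁻ x, ‖a x - u₁‖ₑ ^ 2 ∂ν := by
  obtain ⟨l, hl, rfl, hK⟩ := h
  have h1 : ∫⁻ x, l x ∂μ = 1 := by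
    have := measure_univ (μ := μ.withDensity l)
    rwa [withDensity_apply _ MeasurableSet.univ, setLIntegral_univ] at this
  have hm : ∀ u : ℝ, Measurable fun x => ‖a x - u‖ₑ ^ 2 := fun u => by fun_prop
  rw [lintegral_withDensity_eq_lintegral_mul _ hl (hm u₁)]
  have key := lintegral_mono (μ := μ) fun x => two_point_pointwise (l x) (a x) u₀ u₁
  rw [lintegral_const_mul _ hl, h1, lintegral_add_right _ (by fun_prop),
    lintegral_add_left (hm u₀), lintegral_const_mul _ (by fun_prop),
    lintegral_add_left hl, h1] at key
  simp only [Pi.mul_apply]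
  set I := ∫⁻ x, ‖a x - u₀‖ₑ ^ 2 ∂μ + ∫⁻ x, l x * ‖a x - u₁‖ₑ ^ 2 ∂μ with hI
  have key2 : ENNReal.ofReal ((u₁ - u₀) ^ 2 / 4) + ENNReal.ofReal ((u₁ - u₀) ^ 2 / 4)
      ≤ I + ENNReal.ofReal ((u₁ - u₀) ^ 2 / 4) := by
    calc _ = ENNReal.ofReal ((u₁ - u₀) ^ 2 / 2) * 1 := by
          rw [← ENNReal.ofReal_add (by positivity) (by positivity), mul_one]; congr 1; ring
      _ ≤ I + ENNReal.ofReal ((u₁ - u₀) ^ 2 / 16) * (1 + ∫⁻ x, l x ^ 2 ∂μ) := key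
      _ ≤ I + ENNReal.ofReal ((u₁ - u₀) ^ 2 / 16) * (1 + 3) := by gcongr
      _ = I + ENNReal.ofReal ((u₁ - u₀) ^ 2 / 4) := by
          rw [show (1 + 3 : ℝ≥0∞) = ENNReal.ofReal 4 by norm_num,
            ← ENNReal.ofReal_mul (by positivity)]
          congr 2; ring
  exact (ENNReal.add_le_add_iff_right ENNReal.ofReal_ne_top).1 key2

/-! ### Likelihood ratios for Gaussian regression data -/

/-- The likelihood ratio of `N(m₁, v)` with respect to `N(m₀, v)` at `y`. -/
noncomputable def gaussianRatio (v m₀ m₁ y : ℝ) : ℝ :=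
  Real.exp ((m₁ - m₀) * (y - m₀) / v - (m₁ - m₀) ^ 2 / (2 * v))

theorem gaussianReal_eq_withDensity (m₀ m₁ : ℝ) {v : ℝ≥0} (hv : v ≠ 0) :
    gaussianReal m₁ v
      = (gaussianReal m₀ v).withDensity fun y => ENNReal.ofReal (gaussianRatio v m₀ m₁ y) := by
  have hv' : (0 : ℝ) < v := by positivity
  rw [gaussianReal_of_var_ne_zero _ hv, gaussianReal_of_var_ne_zero _ hv,
    ← withDensity_mul _ (measurable_gaussianPDF m₀ v) (by unfold gaussianRatio; fun_prop)]
  congr 1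
  ext y
  rw [Pi.mul_apply, gaussianPDF, gaussianPDF,
    ← ENNReal.ofReal_mul (gaussianPDFReal_nonneg _ _ _), gaussianPDFReal, gaussianPDFReal,
    gaussianRatio, mul_assoc (√_)⁻¹, ← Real.exp_add]
  congr 3
  field_simp
  ring

/-- Completing the square: the squared ratio is a constant times the likelihood ratio of the
Gaussian with mean 2m₁ - m₀, which integrates to one. -/
theorem lintegral_gaussianRatio_sq (m₀ m₁ : ℝ) {v : ℝ≥0} (hv : v ≠ 0) :
    ∫⁻ y, ENNReal.ofReal (gaussianRatio v m₀ m₁ y) ^ 2 ∂(gaussianReal m₀ v)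
      = ENNReal.ofReal (Real.exp ((m₁ - m₀) ^ 2 / v)) := by
  have hv' : (0 : ℝ) < v := by positivity
  have h : ∀ y, ENNReal.ofReal (gaussianRatio v m₀ m₁ y) ^ 2
      = ENNReal.ofReal (Real.exp ((m₁ - m₀) ^ 2 / v))
        * ENNReal.ofReal (gaussianRatio v m₀ (2 * m₁ - m₀) y) := by
    intro y
    rw [gaussianRatio, gaussianRatio, ← ENNReal.ofReal_pow (Real.exp_pos _).le,
      ← ENNReal.ofReal_mul (Real.exp_pos _).le, ← Real.exp_nat_mul, ← Real.exp_add]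
    congr 2
    field_simp
    push_cast
    ring
  have hm : Measurable fun y => ENNReal.ofReal (gaussianRatio v m₀ (2 * m₁ - m₀) y) := by
    unfold gaussianRatio; fun_prop
  simp_rw [h]
  rw [lintegral_const_mul _ hm, ← setLIntegral_univ, ← withDensity_apply _ MeasurableSet.univ,
    ← gaussianReal_eq_withDensity m₀ _ hv, measure_univ, mul_one]

instance gaussianNoise.isMarkovKernel (σ : ℝ) : IsMarkovKernel (gaussianNoise σ) := by
  unfold gaussianNoise; infer_instance

instance observationLaw.isProbabilityMeasure (μ : Measure unitInterval) [IsProbabilityMeasure μ]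
    {f : unitInterval → ℝ} [hf : Fact (Measurable f)] (σ : ℝ) :
    IsProbabilityMeasure (observationLaw μ f (gaussianNoise σ)) := by
  have := hf.out
  exact Measure.isProbabilityMeasure_map (by fun_prop)

theorem lintegral_observationLaw (μ : Measure unitInterval) [IsProbabilityMeasure μ]
    {f : unitInterval → ℝ} (hf : Measurable f) (σ : ℝ) {F : unitInterval × ℝ → ℝ≥0∞}
    (hF : Measurable F) :
    ∫⁻ z, F z ∂(observationLaw μ f (gaussianNoise σ))
      = ∫⁻ x, ∫⁻ y, F (x, y) ∂(gaussianReal (f x) (σ ^ 2).toNNReal) ∂μ := by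
  rw [observationLaw, lintegral_map hF (by fun_prop), Measure.lintegral_compProd (by fun_prop)]
  refine lintegral_congr fun x => ?_
  have : gaussianReal (f x) (σ ^ 2).toNNReal
      = (gaussianReal 0 (σ ^ 2).toNNReal).map (f x + ·) := by
    rw [gaussianReal_map_const_add, zero_add]
  rw [this, lintegral_map (by fun_prop) (by fun_prop), gaussianNoise, Kernel.const_apply]

/-- The covariate law is common to both models, so the likelihood ratio at (x, y) is the Gaussian
one between the means f x and g x. -/
theorem hasSqDensityLE_observationLaw (μ : Measure unitInterval) [IsProbabilityMeasure μ]
    {f g : unitInterval → ℝ} (hf : Measurable f) (hg : Measurable g) {σ : ℝ} (hσ : 0 < σ) :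
    HasSqDensityLE (observationLaw μ f (gaussianNoise σ)) (observationLaw μ g (gaussianNoise σ))
      (∫⁻ x, ENNReal.ofReal (Real.exp ((g x - f x) ^ 2 / σ ^ 2)) ∂μ) := by
  have hv : (σ ^ 2).toNNReal ≠ 0 := by rw [ne_eq, Real.toNNReal_eq_zero, not_le]; positivity
  have hvσ : ((σ ^ 2).toNNReal : ℝ) = σ ^ 2 := Real.coe_toNNReal _ (by positivity)
  have hl : Measurable fun z : unitInterval × ℝ =>
      ENNReal.ofReal (gaussianRatio (σ ^ 2).toNNReal (f z.1) (g z.1) z.2) := by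
    unfold gaussianRatio; fun_prop
  refine ⟨_, hl, ?_, ?_⟩
  · refine Measure.ext_of_lintegral _ fun F hF => ?_
    rw [lintegral_withDensity_eq_lintegral_mul _ hl hF, lintegral_observationLaw μ hg σ hF,
      lintegral_observationLaw μ hf σ (hl.mul hF)]
    refine lintegral_congr fun x => ?_
    rw [gaussianReal_eq_withDensity (f x) (g x) hv,
      lintegral_withDensity_eq_lintegral_mul _ (by unfold gaussianRatio; fun_prop)
        (by fun_prop)]
    rfl
  · rw [lintegral_observationLaw μ hf σ (hl.pow_const 2)]
    refine (lintegral_congr fun x => ?_).le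
    exact (lintegral_gaussianRatio_sq (f x) (g x) hv).trans (by rw [hvσ])

theorem dataLaw.isProbabilityMeasure (nP nQ : ℕ) (P Q : Measure unitInterval)
    [IsProbabilityMeasure P] [IsProbabilityMeasure Q] {f : unitInterval → ℝ} (hf : Measurable f)
    (σ : ℝ) : IsProbabilityMeasure (dataLaw nP nQ P Q f (gaussianNoise σ)) := by
  have : Fact (Measurable f) := ⟨hf⟩
  unfold dataLaw; infer_instance

theorem hasSqDensityLE_dataLaw (nP nQ : ℕ) (P Q : Measure unitInterval)
    [IsProbabilityMeasure P] [IsProbabilityMeasure Q] {f g : unitInterval → ℝ}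
    (hf : Measurable f) (hg : Measurable g) {σ : ℝ} (hσ : 0 < σ) :
    HasSqDensityLE (dataLaw nP nQ P Q f (gaussianNoise σ)) (dataLaw nP nQ P Q g (gaussianNoise σ))
      ((∫⁻ x, ENNReal.ofReal (Real.exp ((g x - f x) ^ 2 / σ ^ 2)) ∂P) ^ nP
        * (∫⁻ x, ENNReal.ofReal (Real.exp ((g x - f x) ^ 2 / σ ^ 2)) ∂Q) ^ nQ) := by
  have : Fact (Measurable f) := ⟨hf⟩
  have : Fact (Measurable g) := ⟨hg⟩
  have h := ((hasSqDensityLE_observationLaw P hf hg hσ).pi (ι := Fin nP)).prod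
    ((hasSqDensityLE_observationLaw Q hf hg hσ).pi (ι := Fin nQ))
  rwa [Fintype.card_fin, Fintype.card_fin] at h

theorem gaussianNoise_mem_noiseClass (σ : ℝ) : gaussianNoise σ ∈ noiseClass σ := by
  refine ⟨inferInstance, fun x => ?_⟩
  rw [gaussianNoise, Kernel.const_apply]
  refine ⟨integral_id_gaussianReal, ?_⟩
  have h : evariance id (gaussianReal 0 (σ ^ 2).toNNReal)
      = ∫⁻ ξ, ‖ξ‖ₑ ^ 2 ∂(gaussianReal 0 (σ ^ 2).toNNReal) := by
    simp [evariance]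
  have h2 := (memLp_id_gaussianReal (μ := 0) (v := (σ ^ 2).toNNReal) 2).ofReal_variance_eq
  rw [← h, ← h2, variance_id_gaussianReal, Real.coe_toNNReal _ (sq_nonneg σ)]

theorem minimaxRisk_mono (nP nQ : ℕ) (P Q : Measure unitInterval) (β L : ℝ)
    {N N' : Set (Kernel unitInterval ℝ)} (h : N ⊆ N') :
    minimaxRisk nP nQ P Q β L N ≤ minimaxRisk nP nQ P Q β L N' :=
  iInf₂_mono fun _ _ => iSup₂_mono fun _ _ => biSup_mono fun _ hν => h hν

/-! ### Hölder bumps on a grid -/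

/-- The distance to a set is 1-Lipschitz, and t ↦ t^β is subadditive for β ≤ 1. -/
theorem infDist_rpow_mem_holderClass {β L : ℝ} (hβ0 : 0 < β) (hβ1 : β ≤ 1) (hL : 0 < L)
    {Z : Set unitInterval} (hZ : 0 ∈ Z) :
    (fun x => L * Metric.infDist x Z ^ β) ∈ holderClass β L := by
  refine ⟨fun x y => ?_, ?_⟩
  · have key : ∀ x y : unitInterval,
        Metric.infDist x Z ^ β ≤ Metric.infDist y Z ^ β + |(x : ℝ) - y| ^ β := by
      intro x y
      have h1 : Metric.infDist x Z ≤ Metric.infDist y Z + |(x : ℝ) - y| :=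
        Metric.infDist_le_infDist_add_dist
      exact (Real.rpow_le_rpow Metric.infDist_nonneg h1 hβ0.le).trans
        (Real.rpow_add_le_add_rpow Metric.infDist_nonneg (abs_nonneg _) hβ0.le hβ1)
    have h1 := key x y
    have h2 := key y x
    rw [abs_sub_comm (y : ℝ) x] at h2
    rw [← mul_sub, abs_mul, abs_of_pos hL]
    gcongr
    rw [abs_le]
    constructor <;> linarith
  · simp [Metric.infDist_zero_of_mem hZ, Real.zero_rpow hβ0.ne']

/-- The point `k r` of the grid of mesh `r`, projected to `[0, 1]`. -/
noncomputable def gridPoint (r : ℝ) (k : ℕ) : unitInterval := Set.projIcc 0 1 zero_le_one (k * r)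

theorem coe_gridPoint {r : ℝ} (hr : 0 < r) {k : ℕ} (hk : (k : ℝ) * r ≤ 1) :
    (gridPoint r k : ℝ) = k * r := by
  rw [gridPoint, Set.projIcc_of_mem zero_le_one ⟨by positivity, hk⟩]

theorem dist_gridPoint {r : ℝ} (hr : 0 < r) {k l : ℕ} (hk : (k : ℝ) * r ≤ 1)
    (hl : (l : ℝ) * r ≤ 1) : dist (gridPoint r k) (gridPoint r l) = |(k : ℝ) - l| * r := by
  rw [Subtype.dist_eq, coe_gridPoint hr hk, coe_gridPoint hr hl, Real.dist_eq, ← sub_mul, abs_mul,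
    abs_of_pos hr]

theorem le_dist_gridPoint {r : ℝ} (hr : 0 < r) {k l : ℕ} (hk : (k : ℝ) * r ≤ 1)
    (hl : (l : ℝ) * r ≤ 1) (hkl : k ≠ l) : r ≤ dist (gridPoint r k) (gridPoint r l) := by
  rw [dist_gridPoint hr hk hl]
  have : (1 : ℝ) ≤ |(k : ℝ) - l| := by
    have h : (1 : ℤ) ≤ |(k : ℤ) - l| := Int.one_le_abs (by omega)
    exact_mod_cast h
  nlinarith

theorem cast_mul_le_one {r : ℝ} (hr : 0 < r) {M k : ℕ} (hMr : 2 * M * r ≤ 1) (hk : k ≤ 2 * M) :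
    (k : ℝ) * r ≤ 1 := by
  have : (k : ℝ) ≤ 2 * M := by exact_mod_cast hk
  nlinarith

/-- The zero set of the bump function indexed by `v`: the even points of the grid, and the odd
points at which `v` vanishes. -/
def bumpZeros (r : ℝ) {M : ℕ} (v : Fin M → Bool) : Set unitInterval :=
  {x | ∃ j : Fin M, x = gridPoint r (2 * j) ∨ (v j = false ∧ x = gridPoint r (2 * j + 1))}

/-- The function with bumps of width `r` at the odd points of the grid selected by `v`. -/
noncomputable def bump (β L r : ℝ) {M : ℕ} (v : Fin M → Bool) (x : unitInterval) : ℝ :=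
  L * Metric.infDist x (bumpZeros r v) ^ β

theorem bump_mem_holderClass {β L r : ℝ} (hβ0 : 0 < β) (hβ1 : β ≤ 1) (hL : 0 < L) {M : ℕ}
    (hM : 0 < M) (v : Fin M → Bool) : bump β L r v ∈ holderClass β L := by
  refine infDist_rpow_mem_holderClass hβ0 hβ1 hL ⟨⟨0, hM⟩, Or.inl ?_⟩
  apply Subtype.ext
  simp [gridPoint, Set.projIcc]

theorem measurable_bump {β L r : ℝ} {M : ℕ} (v : Fin M → Bool) :
    Measurable (bump β L r v) := by
  unfold bump
  fun_prop

theorem bump_even {β L r : ℝ} (hβ0 : 0 < β) {M : ℕ} (v : Fin M → Bool) (j : Fin M) :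
    bump β L r v (gridPoint r (2 * j)) = 0 := by
  rw [bump, Metric.infDist_zero_of_mem (show _ ∈ bumpZeros r v from ⟨j, Or.inl rfl⟩), Real.zero_rpow hβ0.ne', mul_zero]

/-- At a selected odd point the even neighbour on the left is a zero at distance exactly r, and no
other zero is closer because all zeros are grid points. -/
theorem bump_odd {β L r : ℝ} (hβ0 : 0 < β) (hr : 0 < r) {M : ℕ} (hMr : 2 * M * r ≤ 1)
    (v : Fin M → Bool) (j : Fin M) :
    bump β L r v (gridPoint r (2 * j + 1)) = if v j then L * r ^ β else 0 := by
  have hb : ∀ k : ℕ, k ≤ 2 * M → (k : ℝ) * r ≤ 1 := fun k => cast_mul_le_one hr hMr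
  have hj := j.2
  cases hv : v j
  · rw [bump,
      Metric.infDist_zero_of_mem (show _ ∈ bumpZeros r v from ⟨j, Or.inr ⟨hv, rfl⟩⟩),
      Real.zero_rpow hβ0.ne', mul_zero]
    simp
  · have hinf : Metric.infDist (gridPoint r (2 * j + 1)) (bumpZeros r v) = r := by
      have hmem : gridPoint r (2 * j) ∈ bumpZeros r v := ⟨j, Or.inl rfl⟩
      refine le_antisymm ((Metric.infDist_le_dist_of_mem hmem).trans ?_) ?_
      · rw [dist_gridPoint hr (hb _ (by omega)) (hb _ (by omega))]
        push_cast
        simp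
      · refine (Metric.le_infDist ⟨_, hmem⟩).2 ?_
        rintro _ ⟨k, rfl | ⟨hk, rfl⟩⟩
        · exact le_dist_gridPoint hr (hb _ (by omega)) (hb _ (by omega)) (by omega)
        · have hne : (j : ℕ) ≠ k := fun h => by
            rw [← Fin.ext h, hv] at hk; exact Bool.noConfusion hk
          exact le_dist_gridPoint hr (hb _ (by omega)) (hb _ (by omega)) (by omega)
    rw [bump, hinf]
    simp

/-! ### Cell laws and Assouad's lemma -/

/-- The covariate law that selects one of the `M` first cells of length `2 r` uniformly, and in
this cell the left end point with probability `1 - p` and the midpoint with probability `p`. -/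
noncomputable def cellLaw (r : ℝ) (M : ℕ) (p : ℝ) : Measure unitInterval :=
  ∑ j : Fin M, (ENNReal.ofReal ((1 - p) / M) • Measure.dirac (gridPoint r (2 * j))
    + ENNReal.ofReal (p / M) • Measure.dirac (gridPoint r (2 * j + 1)))

theorem lintegral_cellLaw (r : ℝ) (M : ℕ) (p : ℝ) (F : unitInterval → ℝ≥0∞) :
    ∫⁻ x, F x ∂(cellLaw r M p)
      = ∑ j : Fin M, (ENNReal.ofReal ((1 - p) / M) * F (gridPoint r (2 * j))
        + ENNReal.ofReal (p / M) * F (gridPoint r (2 * j + 1))) := by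
  simp [cellLaw, lintegral_finsetSum_measure, lintegral_add_measure]

theorem lintegral_cellLaw_one (r : ℝ) (M : ℕ) (F : unitInterval → ℝ≥0∞) :
    ∫⁻ x, F x ∂(cellLaw r M 1)
      = ∑ j : Fin M, ENNReal.ofReal (1 / M) * F (gridPoint r (2 * j + 1)) := by
  simp [lintegral_cellLaw]

theorem isProbabilityMeasure_cellLaw (r : ℝ) {M : ℕ} (hM : 0 < M) {p : ℝ} (hp0 : 0 ≤ p)
    (hp1 : p ≤ 1) : IsProbabilityMeasure (cellLaw r M p) := by
  refine ⟨?_⟩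
  have hM' : (0 : ℝ) < M := by exact_mod_cast hM
  have h1 : (1 - p) / M + p / M = 1 / M := by ring
  rw [← lintegral_one, lintegral_cellLaw]
  simp only [mul_one]
  rw [← ENNReal.ofReal_add (div_nonneg (by linarith) hM'.le) (by positivity), h1, Finset.sum_const,
    Finset.card_univ, Fintype.card_fin, nsmul_eq_mul, ← ENNReal.ofReal_natCast,
    ← ENNReal.ofReal_mul hM'.le, mul_one_div_cancel hM'.ne', ENNReal.ofReal_one]

/-- The functions differ at a single atom of mass p/M, so the integral equals 1 + (p/M)(e^s - 1).
Then e^s - 1 ≤ 2s on [0,1] and 1 + u ≤ e^u give a form that multiplies well over the sample. -/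
theorem lintegral_exp_cellLaw_le (r : ℝ) {M : ℕ} (hM : 0 < M) {p : ℝ} (hp0 : 0 ≤ p) (hp1 : p ≤ 1)
    {f g : unitInterval → ℝ} {σ s : ℝ} (hs0 : 0 ≤ s) (hs1 : s ≤ 1) (j : Fin M)
    (heven : ∀ k : Fin M, g (gridPoint r (2 * k)) = f (gridPoint r (2 * k)))
    (hodd : ∀ k : Fin M, k ≠ j → g (gridPoint r (2 * k + 1)) = f (gridPoint r (2 * k + 1)))
    (hj : (g (gridPoint r (2 * j + 1)) - f (gridPoint r (2 * j + 1))) ^ 2 / σ ^ 2 = s) :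
    ∫⁻ x, ENNReal.ofReal (Real.exp ((g x - f x) ^ 2 / σ ^ 2)) ∂(cellLaw r M p)
      ≤ ENNReal.ofReal (Real.exp (2 * s * (p / M))) := by
  have hM' : (0 : ℝ) < M := by exact_mod_cast hM
  have hq : 0 ≤ (1 - p) / M := div_nonneg (by linarith) hM'.le
  have hterm : ∀ k : Fin M,
      ENNReal.ofReal ((1 - p) / M)
          * ENNReal.ofReal (Real.exp ((g (gridPoint r (2 * k)) - f (gridPoint r (2 * k))) ^ 2 / σ ^ 2))
        + ENNReal.ofReal (p / M) * ENNReal.ofReal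
          (Real.exp ((g (gridPoint r (2 * k + 1)) - f (gridPoint r (2 * k + 1))) ^ 2 / σ ^ 2))
      = ENNReal.ofReal (1 / M + if k = j then p / M * (Real.exp s - 1) else 0) := by
    intro k
    rw [heven k]
    by_cases hk : k = j
    · subst hk
      rw [hj, if_pos rfl, ← ENNReal.ofReal_mul hq, ← ENNReal.ofReal_mul (by positivity),
        ← ENNReal.ofReal_add (by positivity) (by positivity)]
      congr 1
      simp only [sub_self, ne_eq, OfNat.ofNat_ne_zero, not_false_eq_true, zero_pow, zero_div,
        Real.exp_zero]
      ring
    · rw [hodd k hk, if_neg hk, ← ENNReal.ofReal_mul hq, ← ENNReal.ofReal_mul (by positivity),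
        ← ENNReal.ofReal_add (by positivity) (by positivity)]
      congr 1
      simp only [sub_self, ne_eq, OfNat.ofNat_ne_zero, not_false_eq_true, zero_pow, zero_div,
        Real.exp_zero]
      ring
  have hexp : 0 ≤ Real.exp s - 1 := by linarith [Real.add_one_le_exp s]
  have hexp2 : Real.exp s - 1 ≤ 2 * s := by
    have h := Real.abs_exp_sub_one_le (x := s) (by rwa [abs_of_nonneg hs0])
    rwa [abs_of_nonneg hexp, abs_of_nonneg hs0] at h
  rw [lintegral_cellLaw, Finset.sum_congr rfl fun k _ => hterm k, ← ENNReal.ofReal_sum_of_nonneg]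
  · apply ENNReal.ofReal_le_ofReal
    rw [Finset.sum_add_distrib, Finset.sum_ite_eq' Finset.univ j, if_pos (Finset.mem_univ j),
      Finset.sum_const, Finset.card_univ, Fintype.card_fin, nsmul_eq_mul, mul_one_div_cancel hM'.ne']
    have h1 : p / M * (Real.exp s - 1) ≤ p / M * (2 * s) := by gcongr
    linarith [Real.add_one_le_exp (2 * s * (p / M))]
  · intro k _
    split_ifs <;> positivity

/-- **Assouad's lemma** for the bump functions: a lower bound for the minimax risk. -/
theorem le_minimaxRisk_cellLaw {β L σ r p : ℝ} (hβ0 : 0 < β) (hβ1 : β ≤ 1) (hL : 0 < L)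
    (hσ : 0 < σ) (hr : 0 < r) {M : ℕ} (hM : 0 < M) (hMr : 2 * M * r ≤ 1) (hp0 : 0 ≤ p)
    (hp1 : p ≤ 1) {nP nQ : ℕ} (hs : (L * r ^ β) ^ 2 / σ ^ 2 ≤ 1)
    (hn : 2 * ((L * r ^ β) ^ 2 / σ ^ 2) * (nP * (p / M) + nQ * (1 / M)) ≤ 1) :
    ENNReal.ofReal ((L * r ^ β) ^ 2 / 8)
      ≤ minimaxRisk nP nQ (cellLaw r M p) (cellLaw r M 1) β L {gaussianNoise σ} := by
  have hM' : (0 : ℝ) < M := by exact_mod_cast hM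
  have := isProbabilityMeasure_cellLaw r hM hp0 hp1
  have := isProbabilityMeasure_cellLaw r hM zero_le_one le_rfl
  set P := cellLaw r M p
  set Q := cellLaw r M 1
  set Δ := L * r ^ β with hΔ
  set s := Δ ^ 2 / σ ^ 2 with hsdef
  have hs0 : 0 ≤ s := by positivity
  refine le_iInf₂ fun fhat hfhat => ?_
  have hfhat' : Measurable (Function.uncurry fhat) := hfhat
  set S := ⨆ f ∈ holderClass β L, ⨆ ν ∈ ({gaussianNoise σ} : Set (Kernel unitInterval ℝ)),
    risk P Q f ν fhat with hS
  let flip (j : Fin M) (v : Fin M → Bool) : Fin M → Bool := Function.update v j (!v j)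
  have hflip : ∀ j, Function.Involutive (flip j) := by
    intro j v
    simp [flip]
  let A (j : Fin M) (v : Fin M → Bool) : ℝ≥0∞ :=
    ∫⁻ D, ‖fhat D (gridPoint r (2 * j + 1)) - bump β L r v (gridPoint r (2 * j + 1))‖ₑ ^ 2
      ∂(dataLaw nP nQ P Q (bump β L r v) (gaussianNoise σ))
  have hfm : ∀ x, Measurable fun D => fhat D x := fun x =>
    hfhat'.comp (measurable_id.prodMk measurable_const)
  -- Since Q is uniform on the midpoints, the risk splits exactly into an average over cells.
  have hrisk : ∀ v : Fin M → Bool, ∑ j, ENNReal.ofReal (1 / M) * A j v ≤ S := by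
    intro v
    calc ∑ j, ENNReal.ofReal (1 / M) * A j v
        = risk P Q (bump β L r v) (gaussianNoise σ) fhat := by
          unfold risk
          simp_rw [Q, lintegral_cellLaw_one]
          rw [lintegral_finsetSum _ fun j _ => by have := hfm (gridPoint r (2 * j + 1)); fun_prop]
          refine Finset.sum_congr rfl fun j _ => ?_
          rw [lintegral_const_mul _ (by have := hfm (gridPoint r (2 * j + 1)); fun_prop)]
      _ ≤ S := by
          refine le_trans ?_ (le_iSup₂ (bump β L r v) (bump_mem_holderClass hβ0 hβ1 hL hM v))
          exact le_iSup₂_of_le _ rfl le_rfl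
  -- Two-point bound for a cube vertex and its neighbour across bit j, which differ by Δ at the
  -- midpoint of cell j and at no other atom.
  have hpair : ∀ j v, ENNReal.ofReal (Δ ^ 2 / 4) ≤ A j v + A j (flip j v) := by
    intro j v
    have hdiff : (bump β L r (flip j v) (gridPoint r (2 * j + 1))
        - bump β L r v (gridPoint r (2 * j + 1))) ^ 2 = Δ ^ 2 := by
      rw [bump_odd hβ0 hr hMr, bump_odd hβ0 hr hMr, ← hΔ]
      cases hv : v j <;> simp [flip, hv]
    have hchi : ∀ q : ℝ, 0 ≤ q → q ≤ 1 →
        ∫⁻ x, ENNReal.ofReal (Real.exp ((bump β L r (flip j v) x - bump β L r v x) ^ 2 / σ ^ 2))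
          ∂(cellLaw r M q) ≤ ENNReal.ofReal (Real.exp (2 * s * (q / M))) := by
      intro q hq0 hq1
      refine lintegral_exp_cellLaw_le r hM hq0 hq1 hs0 hs j (fun k => ?_) (fun k hk => ?_) ?_
      · rw [bump_even hβ0, bump_even hβ0]
      · rw [bump_odd hβ0 hr hMr, bump_odd hβ0 hr hMr]
        simp [flip, Function.update_of_ne hk]
      · rw [hdiff]
    have hdens := hasSqDensityLE_dataLaw nP nQ P Q (measurable_bump (β := β) (L := L) (r := r) v)
      (measurable_bump (β := β) (L := L) (r := r) (flip j v)) hσ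
    have h3 : HasSqDensityLE (dataLaw nP nQ P Q (bump β L r v) (gaussianNoise σ))
        (dataLaw nP nQ P Q (bump β L r (flip j v)) (gaussianNoise σ)) 3 := by
      obtain ⟨l, hl, he, hK⟩ := hdens
      refine ⟨l, hl, he, hK.trans ?_⟩
      calc _ ≤ ENNReal.ofReal (Real.exp (2 * s * (p / M))) ^ nP
            * ENNReal.ofReal (Real.exp (2 * s * (1 / M))) ^ nQ := by
            gcongr
            · exact hchi p hp0 hp1
            · exact hchi 1 zero_le_one le_rfl
        _ = ENNReal.ofReal (Real.exp (2 * s * (nP * (p / M) + nQ * (1 / M)))) := by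
            rw [← ENNReal.ofReal_pow (Real.exp_pos _).le, ← ENNReal.ofReal_pow (Real.exp_pos _).le,
              ← ENNReal.ofReal_mul (by positivity), ← Real.exp_nat_mul, ← Real.exp_nat_mul,
              ← Real.exp_add]
            congr 2
            ring
        _ ≤ ENNReal.ofReal 3 := by
            apply ENNReal.ofReal_le_ofReal
            -- The hypothesis on the sample sizes bounds the exponent by 1, and e < 3 meets the
            -- threshold of the two-point lemma.
            exact (Real.exp_le_exp.2 hn).trans Real.exp_one_lt_three.le
        _ = 3 := by norm_num
    have := dataLaw.isProbabilityMeasure nP nQ P Q (measurable_bump (β := β) (L := L) (r := r) v) σ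
    have := dataLaw.isProbabilityMeasure nP nQ P Q
      (measurable_bump (β := β) (L := L) (r := r) (flip j v)) σ
    have := h3.two_point (hfm (gridPoint r (2 * j + 1)))
      (bump β L r v (gridPoint r (2 * j + 1))) (bump β L r (flip j v) (gridPoint r (2 * j + 1)))
    rwa [hdiff] at this
  set N : ℝ≥0∞ := (Fintype.card (Fin M → Bool) : ℝ≥0∞) with hN
  have hN0 : N ≠ 0 := by simp [hN]
  have hNtop : N ≠ ∞ := ENNReal.natCast_ne_top _
  have hsum : ∀ j, N * ENNReal.ofReal (Δ ^ 2 / 4) ≤ 2 * ∑ v, A j v := by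
    intro j
    calc N * ENNReal.ofReal (Δ ^ 2 / 4) = ∑ _v : Fin M → Bool, ENNReal.ofReal (Δ ^ 2 / 4) := by
          rw [Finset.sum_const, Finset.card_univ, nsmul_eq_mul]
      _ ≤ ∑ v, (A j v + A j (flip j v)) := Finset.sum_le_sum fun v _ => hpair j v
      _ = 2 * ∑ v, A j v := by
          rw [Finset.sum_add_distrib, two_mul]
          congr 1
          -- Flipping bit j permutes the cube, so both halves of the sum are equal.
          exact Equiv.sum_comp (hflip j).toPerm (A j)
  have hfin : N * ENNReal.ofReal (Δ ^ 2 / 4) ≤ N * (2 * S) := by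
    calc N * ENNReal.ofReal (Δ ^ 2 / 4)
        = ∑ _j : Fin M, ENNReal.ofReal (1 / M) * (N * ENNReal.ofReal (Δ ^ 2 / 4)) := by
          rw [← Finset.sum_mul, Finset.sum_const, Finset.card_univ, Fintype.card_fin, nsmul_eq_mul,
            ← ENNReal.ofReal_natCast, ← ENNReal.ofReal_mul hM'.le, mul_one_div_cancel hM'.ne',
            ENNReal.ofReal_one, one_mul]
      _ ≤ ∑ j : Fin M, ENNReal.ofReal (1 / M) * (2 * ∑ v, A j v) := by
          exact Finset.sum_le_sum fun j _ => mul_le_mul' le_rfl (hsum j)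
      _ = 2 * ∑ v, ∑ j, ENNReal.ofReal (1 / M) * A j v := by
          rw [Finset.sum_comm, Finset.mul_sum]
          refine Finset.sum_congr rfl fun j _ => ?_
          rw [← Finset.mul_sum]
          ring
      _ ≤ 2 * ∑ _v : Fin M → Bool, S := by
          gcongr with v
          exact hrisk v
      _ = N * (2 * S) := by
          rw [Finset.sum_const, Finset.card_univ, nsmul_eq_mul]
          ring
  have h2 : ENNReal.ofReal (Δ ^ 2 / 4) ≤ 2 * S := (ENNReal.mul_le_mul_iff_right hN0 hNtop).1 hfin
  have h3 : ENNReal.ofReal (Δ ^ 2 / 4) = 2 * ENNReal.ofReal (Δ ^ 2 / 8) := by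
    rw [show (2 : ℝ≥0∞) = ENNReal.ofReal 2 by norm_num, ← ENNReal.ofReal_mul zero_le_two]
    congr 1
    ring
  rw [h3] at h2
  exact (ENNReal.mul_le_mul_iff_right two_ne_zero ENNReal.ofNat_ne_top).1 h2

/-! ### Membership of the cell laws in the similarity families -/

theorem cellLaw_apply (r : ℝ) (M : ℕ) (p : ℝ) {B : Set unitInterval} (hB : MeasurableSet B) :
    cellLaw r M p B = ∑ j : Fin M, (ENNReal.ofReal ((1 - p) / M) * B.indicator 1 (gridPoint r (2 * j))
        + ENNReal.ofReal (p / M) * B.indicator 1 (gridPoint r (2 * j + 1))) := by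
  rw [← lintegral_cellLaw, lintegral_indicator_one hB]

theorem le_cellLaw_of_odd_mem (r : ℝ) {M : ℕ} (p : ℝ) {B : Set unitInterval}
    (hB : MeasurableSet B) (j : Fin M) (hj : gridPoint r (2 * j + 1) ∈ B) :
    ENNReal.ofReal (p / M) ≤ cellLaw r M p B := by
  rw [cellLaw_apply r M p hB]
  refine le_trans ?_ (Finset.single_le_sum (fun _ _ => zero_le) (Finset.mem_univ j))
  simp [hj]

theorem le_cellLaw_of_even_mem (r : ℝ) {M : ℕ} (p : ℝ) {B : Set unitInterval}
    (hB : MeasurableSet B) (s : Finset (Fin M)) (hs : ∀ k ∈ s, gridPoint r (2 * k) ∈ B) :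
    s.card * ENNReal.ofReal ((1 - p) / M) ≤ cellLaw r M p B := by
  rw [cellLaw_apply r M p hB, ← nsmul_eq_mul, ← Finset.sum_const]
  refine (Finset.sum_le_sum fun k hk => ?_).trans
    (Finset.sum_le_sum_of_subset (Finset.subset_univ s))
  simp [hs k hk]

theorem one_le_cellLaw (r : ℝ) {M : ℕ} (hM : 0 < M) {p : ℝ} (hp0 : 0 ≤ p) (hp1 : p ≤ 1)
    {B : Set unitInterval} (hB : MeasurableSet B)
    (h : ∀ k : Fin M, gridPoint r (2 * k) ∈ B ∧ gridPoint r (2 * k + 1) ∈ B) :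
    1 ≤ cellLaw r M p B := by
  have := isProbabilityMeasure_cellLaw r hM hp0 hp1
  rw [← measure_univ (μ := cellLaw r M p), cellLaw_apply r M p hB,
    cellLaw_apply r M p MeasurableSet.univ]
  refine (Finset.sum_congr rfl fun k _ => ?_).le
  simp [(h k).1, (h k).2]

theorem similarity_cellLaw_le {r : ℝ} {M : ℕ} (hM : 0 < M) {P : Measure unitInterval} {h : ℝ}
    {m : ℝ≥0∞} (hm : ∀ j : Fin M, m ≤ P (Metric.closedBall (gridPoint r (2 * j + 1)) h)) :
    similarity h P (cellLaw r M 1) ≤ m⁻¹ := by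
  have := isProbabilityMeasure_cellLaw r hM zero_le_one le_rfl
  calc similarity h P (cellLaw r M 1) ≤ ∫⁻ _, m⁻¹ ∂(cellLaw r M 1) := by
        rw [similarity, lintegral_cellLaw_one, lintegral_cellLaw_one]
        exact Finset.sum_le_sum fun j _ => mul_le_mul' le_rfl (ENNReal.inv_le_inv.2 (hm j))
    _ = m⁻¹ := by rw [lintegral_const, measure_univ, mul_one]

theorem iSup_similarity_cellLaw_le {r α C : ℝ} {M : ℕ} (hM : 0 < M) {P : Measure unitInterval}
    (hC : 1 ≤ C) (hP : ∀ h ∈ Set.Ioc (0 : ℝ) 1, ∀ j : Fin M,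
      ENNReal.ofReal (h ^ α) ≤ P (Metric.closedBall (gridPoint r (2 * j + 1)) h)) :
    (⨆ h ∈ Set.Ioc (0 : ℝ) 1, ENNReal.ofReal (h ^ α) * similarity h P (cellLaw r M 1))
      ≤ ENNReal.ofReal C := by
  refine iSup₂_le fun h hh => ?_
  calc ENNReal.ofReal (h ^ α) * similarity h P (cellLaw r M 1)
      ≤ ENNReal.ofReal (h ^ α) * (ENNReal.ofReal (h ^ α))⁻¹ :=
        mul_le_mul' le_rfl (similarity_cellLaw_le hM (hP h hh))
    _ ≤ 1 := ENNReal.mul_inv_le_one _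
    _ ≤ ENNReal.ofReal C := by rwa [ENNReal.one_le_ofReal]

theorem ofReal_rpow_le_cellLaw_of_lt {r α p h : ℝ} {M : ℕ} (hα : 0 < α) (hh0 : 0 < h)
    (hhr : h < r) (hp : p / M = r ^ α) (j : Fin M) :
    ENNReal.ofReal (h ^ α)
      ≤ cellLaw r M p (Metric.closedBall (gridPoint r (2 * j + 1)) h) := by
  refine le_trans ?_ (le_cellLaw_of_odd_mem r p Metric.isClosed_closedBall.measurableSet j
    (Metric.mem_closedBall_self hh0.le))
  rw [hp]
  exact ENNReal.ofReal_le_ofReal (Real.rpow_le_rpow hh0.le hhr.le hα.le)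

/-- For h < r the midpoint alone has mass r^α ≥ h^α; for h ≥ r the ball contains both atoms of P and
has mass 1. -/
theorem iSup_similarity_one_cell_le {r α C : ℝ} (hα : 0 < α) (hC : 1 ≤ C) (hr : 0 < r)
    (hr1 : r ≤ 1) :
    (⨆ h ∈ Set.Ioc (0 : ℝ) 1,
      ENNReal.ofReal (h ^ α) * similarity h (cellLaw r 1 (r ^ α)) (cellLaw r 1 1))
      ≤ ENNReal.ofReal C := by
  refine iSup_similarity_cellLaw_le one_pos hC fun h hh j => ?_
  rcases lt_or_ge h r with hhr | hhr
  · exact ofReal_rpow_le_cellLaw_of_lt hα hh.1 hhr (by simp) j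
  · refine (ENNReal.ofReal_le_one.2 (Real.rpow_le_one hh.1.le hh.2 hα.le)).trans ?_
    refine one_le_cellLaw r one_pos (by positivity) (Real.rpow_le_one hr.le hr1 hα.le)
      Metric.isClosed_closedBall.measurableSet fun k => ?_
    rw [Subsingleton.elim k j]
    refine ⟨?_, Metric.mem_closedBall_self hh.1.le⟩
    have hj : (j : ℕ) = 0 := by omega
    rw [Metric.mem_closedBall, dist_gridPoint hr (by simp) (by simpa [hj] using hr1)]
    simpa [hj] using hhr

theorem iSup_similarity_self_one_cell_le {r C : ℝ} (hC : 1 ≤ C) :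
    (⨆ h ∈ Set.Ioc (0 : ℝ) 1, similarity h (cellLaw r 1 1) (cellLaw r 1 1))
      ≤ ENNReal.ofReal C := by
  refine iSup₂_le fun h hh => ?_
  have h1 : similarity h (cellLaw r 1 1) (cellLaw r 1 1) ≤ (1 : ℝ≥0∞)⁻¹ := by
    refine similarity_cellLaw_le one_pos fun j => ?_
    have := le_cellLaw_of_odd_mem r 1 (B := Metric.closedBall (gridPoint r (2 * j + 1)) h)
      Metric.isClosed_closedBall.measurableSet j (Metric.mem_closedBall_self hh.1.le)
    simpa using this
  rw [inv_one] at h1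
  exact h1.trans (by rwa [ENNReal.one_le_ofReal])

/-- With m the integer part of (h/r - 1)/2, every index k with |k - j| ≤ m has its even point at
distance at most (2m + 1) r ≤ h. If the window does not cover all cells, one of its sides is uncut,
so at least m + 1 indices remain, and h < (2m + 3) r ≤ 3 (m + 1) r. -/
theorem exists_finset_even_mem_closedBall {r h : ℝ} (hr : 0 < r) (hhr : r ≤ h) {M : ℕ}
    (hMr : 2 * M * r ≤ 1) (j : Fin M) :
    ∃ s : Finset (Fin M), (s.card = M ∨ h / (3 * r) ≤ s.card) ∧
      ∀ k ∈ s, gridPoint r (2 * k) ∈ Metric.closedBall (gridPoint r (2 * j + 1)) h := by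
  have hj := j.2
  set x := (h / r - 1) / 2 with hx
  have hx0 : 0 ≤ x := by
    have : 1 ≤ h / r := (one_le_div hr).2 hhr
    rw [hx]; linarith
  set m := ⌊x⌋₊ with hm
  have hm1 : (m : ℝ) ≤ x := Nat.floor_le hx0
  have hm2 : x < m + 1 := Nat.lt_floor_add_one x
  have hxh : (2 * x + 1) * r = h := by rw [hx]; field_simp; ring
  have hb : ∀ k : ℕ, k ≤ 2 * M → (k : ℝ) * r ≤ 1 := fun k => cast_mul_le_one hr hMr
  have hlt : ∀ k ∈ Finset.Ico (j - m : ℕ) (min M (j + m + 1)), k < M := by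
    intro k hk
    rw [Finset.mem_Ico] at hk
    omega
  refine ⟨(Finset.Ico (j - m : ℕ) (min M (j + m + 1))).attachFin hlt, ?_, ?_⟩
  · rw [Finset.card_attachFin, Nat.card_Ico]
    by_cases hc : min M (j + m + 1) - (j - m : ℕ) = M
    · exact Or.inl hc
    · right
      have h1 : m + 1 ≤ min M (j + m + 1) - (j - m : ℕ) := by omega
      have h2 : (m : ℝ) + 1 ≤ ((min M (j + m + 1) - (j - m : ℕ) : ℕ) : ℝ) := by exact_mod_cast h1
      rw [div_le_iff₀ (by positivity)]
      have h3 : (2 * x + 1) * r ≤ ((m : ℝ) + 1) * (3 * r) := by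
        have : (0 : ℝ) ≤ m := Nat.cast_nonneg m
        nlinarith
      calc h = (2 * x + 1) * r := hxh.symm
        _ ≤ ((m : ℝ) + 1) * (3 * r) := h3
        _ ≤ _ := by gcongr
  · intro k hk
    rw [Finset.mem_attachFin, Finset.mem_Ico] at hk
    have hk2 := k.2
    rw [Metric.mem_closedBall, dist_gridPoint hr (hb _ (by omega)) (hb _ (by omega))]
    have h1 : |((2 * (k : ℕ) : ℕ) : ℤ) - (2 * (j : ℕ) + 1 : ℕ)| ≤ 2 * m + 1 := by
      rw [abs_le]; omega
    have h2 : |((2 * (k : ℕ) : ℕ) : ℝ) - (2 * (j : ℕ) + 1 : ℕ)| ≤ 2 * m + 1 := by exact_mod_cast h1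
    calc _ ≤ (2 * (m : ℝ) + 1) * r := by gcongr
      _ ≤ (2 * x + 1) * r := by gcongr
      _ = h := hxh

/-- There are three scales. Below r the midpoint has mass r^α. From 2Mr on, the ball contains every
atom. In between, the left end points give mass at least h, which dominates h^α because α > 1. The
condition 8Mr ≤ 1 leaves room for the constants: it forces p ≤ 1/8. -/
theorem iSup_similarity_many_cells_le {r α C : ℝ} (hα : 1 < α) (hC : 1 ≤ C) (hr : 0 < r) {M : ℕ}
    (hM : 0 < M) (hMr : 8 * M * r ≤ 1) :
    (⨆ h ∈ Set.Ioc (0 : ℝ) 1,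
      ENNReal.ofReal (h ^ α) * similarity h (cellLaw r M (M * r ^ α)) (cellLaw r M 1))
      ≤ ENNReal.ofReal C := by
  have hM' : (1 : ℝ) ≤ M := by exact_mod_cast hM
  have hMr' : (M : ℝ) * r ≤ 1 / 8 := by linarith
  have hMr2 : 2 * (M : ℝ) * r ≤ 1 := by linarith
  have hr1 : r ≤ 1 := by nlinarith
  have hrα : r ^ α ≤ r := by
    simpa using Real.rpow_le_rpow_of_exponent_ge hr hr1 hα.le
  have hp0 : 0 ≤ M * r ^ α := by positivity
  have hp : M * r ^ α ≤ 1 / 8 := (by gcongr : M * r ^ α ≤ M * r).trans hMr'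
  have hb : ∀ k : ℕ, k ≤ 2 * M → (k : ℝ) * r ≤ 1 := fun k => cast_mul_le_one hr hMr2
  refine iSup_similarity_cellLaw_le hM hC fun h hh j => ?_
  have hmeas : MeasurableSet (Metric.closedBall (gridPoint r (2 * j + 1)) h) :=
    Metric.isClosed_closedBall.measurableSet
  rcases lt_or_ge h r with hhr | hhr
  · exact ofReal_rpow_le_cellLaw_of_lt (by linarith) hh.1 hhr (by field_simp) j
  rcases le_or_gt (2 * M * r) h with hbig | hsmall
  · refine (ENNReal.ofReal_le_one.2 (Real.rpow_le_one hh.1.le hh.2 (by linarith))).trans ?_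
    refine one_le_cellLaw r hM hp0 (by linarith) hmeas fun k => ?_
    have hball : ∀ l : ℕ, l ≤ 2 * M →
        gridPoint r l ∈ Metric.closedBall (gridPoint r (2 * j + 1)) h := by
      intro l hl
      rw [Metric.mem_closedBall, dist_gridPoint hr (hb _ hl) (hb _ (by omega))]
      have h1 : |(l : ℤ) - (2 * (j : ℕ) + 1 : ℕ)| ≤ 2 * M := by rw [abs_le]; omega
      have h2 : |(l : ℝ) - (2 * (j : ℕ) + 1 : ℕ)| ≤ 2 * M := by exact_mod_cast h1
      exact (mul_le_mul_of_nonneg_right h2 hr.le).trans hbig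
    exact ⟨hball _ (by omega), hball _ (by omega)⟩
  · obtain ⟨s, hs, hmem⟩ := exists_finset_even_mem_closedBall hr hhr hMr2 j
    refine le_trans ?_ (le_cellLaw_of_even_mem r (M * r ^ α) hmeas s hmem)
    rw [← ENNReal.ofReal_natCast, ← ENNReal.ofReal_mul (Nat.cast_nonneg _)]
    apply ENNReal.ofReal_le_ofReal
    have hhα : h ^ α ≤ h := by
      simpa using Real.rpow_le_rpow_of_exponent_ge hh.1 hh.2 hα.le
    refine hhα.trans ?_
    rw [mul_div_assoc', le_div_iff₀ (by positivity)]
    -- With all M points, h < 2Mr ≤ 1/4 is below 1 - p. Otherwise h M ≤ 3Mr · card ≤ (3/8) card,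
    -- again below (1 - p) card.
    rcases hs with hs | hs
    · rw [hs]
      nlinarith
    · rw [div_le_iff₀ (by positivity)] at hs
      have hc : (0 : ℝ) ≤ s.card := Nat.cast_nonneg _
      have h1 : h * M ≤ s.card * (3 * (M * r)) := by nlinarith
      nlinarith

/-! ### Choice of the bandwidth and conclusion -/

/-- Choice of the bandwidth `r = κ T ^ (-1 / γ)` with `T = (a ^ (γ / (2 β + α)) + b)`. -/
theorem exists_bandwidth {β α γ L : ℝ} (hβ : 0 < β) (hα : 0 < α) (hγ : 2 * β ≤ γ) (hL : 0 < L) :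
    ∃ y : ℝ, 0 < y ∧ ∀ σ : ℝ, 0 < σ → ∃ n₀ : ℕ, ∀ nP nQ : ℕ, n₀ ≤ max nP nQ →
      ∃ r : ℝ, 0 < r ∧ r ≤ 1 / 16 ∧ L ^ 2 * r ^ (2 * β) / σ ^ 2 ≤ 1 ∧
        r ^ (2 * β) = y * (((nP : ℝ) / σ ^ 2) ^ (γ / (2 * β + α)) + nQ / σ ^ 2) ^ (-(2 * β / γ)) ∧
        34 * L ^ 2 * (nP / σ ^ 2 * r ^ (2 * β + α)) ≤ 1 ∧
        34 * L ^ 2 * (nQ / σ ^ 2 * r ^ γ) ≤ 1 := by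
  have hγ0 : 0 < γ := by linarith
  have hδ : 0 < 2 * β + α := by linarith
  -- The constant 34 = 2(1 + 16) pays for the factor 2 in Assouad's condition and for 1/M ≤ 16 r in
  -- the many-cell case. As y is fixed before σ, the final constant does not depend on σ.
  set y := min 1 (1 / (34 * L ^ 2)) with hy
  have hy0 : 0 < y := lt_min one_pos (by positivity)
  have hy1 : y ≤ 1 := min_le_left _ _
  have hyL : 34 * L ^ 2 * y ≤ 1 := by
    have : y ≤ 1 / (34 * L ^ 2) := min_le_right _ _
    rwa [le_div_iff₀ (by positivity), mul_comm] at this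
  refine ⟨y, hy0, fun σ hσ => ?_⟩
  set κ := y ^ (1 / (2 * β)) with hκ
  have hκ0 : 0 < κ := by positivity
  have hκ1 : κ ≤ 1 := Real.rpow_le_one hy0.le hy1 (by positivity)
  have hκy : κ ^ (2 * β) = y := by
    rw [hκ, ← Real.rpow_mul hy0.le, one_div_mul_cancel (by positivity), Real.rpow_one]
  -- Since κ ≤ 1, one choice of κ serves both exponents 2β + α and γ, each at least 2β.
  have hκle : ∀ e, 2 * β ≤ e → κ ^ e ≤ y := fun e he => by
    rw [← hκy]; exact Real.rpow_le_rpow_of_exponent_ge hκ0 hκ1 he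
  have hlim : Filter.Tendsto (fun T : ℝ => κ * T ^ (-(1 / γ))) Filter.atTop (nhds 0) := by
    simpa using (tendsto_rpow_neg_atTop (y := 1 / γ) (by positivity)).const_mul κ
  have hlim2 : Filter.Tendsto (fun T : ℝ => L ^ 2 * (κ * T ^ (-(1 / γ))) ^ (2 * β) / σ ^ 2)
      Filter.atTop (nhds 0) := by
    have h := ((hlim.rpow_const (p := 2 * β) (Or.inr (by positivity))).const_mul (L ^ 2)).div_const
      (σ ^ 2)
    rwa [Real.zero_rpow (by positivity), mul_zero, zero_div] at h
  have hev := ((hlim.eventually_le_const (show (0 : ℝ) < 1 / 16 by norm_num)).and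
    (hlim2.eventually_le_const one_pos)).and (Filter.eventually_gt_atTop 0)
  obtain ⟨T₀, hT₀⟩ := Filter.eventually_atTop.1 hev
  have hlimA : Filter.Tendsto (fun n : ℕ => ((n : ℝ) / σ ^ 2) ^ (γ / (2 * β + α)))
      Filter.atTop Filter.atTop :=
    (tendsto_rpow_atTop (by positivity)).comp
      (tendsto_natCast_atTop_atTop.atTop_div_const (by positivity))
  have hlimB : Filter.Tendsto (fun n : ℕ => (n : ℝ) / σ ^ 2) Filter.atTop Filter.atTop :=
    tendsto_natCast_atTop_atTop.atTop_div_const (by positivity)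
  obtain ⟨n₀, hn₀⟩ := Filter.eventually_atTop.1
    ((hlimA.eventually_ge_atTop T₀).and (hlimB.eventually_ge_atTop T₀))
  refine ⟨n₀, fun nP nQ hn => ?_⟩
  set A := ((nP : ℝ) / σ ^ 2) ^ (γ / (2 * β + α)) with hA
  set B := (nQ : ℝ) / σ ^ 2 with hB
  have hA0 : 0 ≤ A := by positivity
  have hB0 : 0 ≤ B := by positivity
  -- One large sample is enough, since either summand alone exceeds T₀.
  have hT : T₀ ≤ A + B := by
    rcases le_max_iff.1 hn with h | h
    · linarith [(hn₀ nP h).1]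
    · linarith [(hn₀ nQ h).2]
  set T := A + B with hTdef
  obtain ⟨⟨hr16, hrs⟩, hT0⟩ := hT₀ T hT
  have hTpow : ∀ e, (κ * T ^ (-(1 / γ))) ^ e = κ ^ e * T ^ (-(e / γ)) := fun e => by
    rw [Real.mul_rpow hκ0.le (by positivity), ← Real.rpow_mul hT0.le]
    congr 2
    ring
  have hTinv : ∀ e : ℝ, T ^ e * T ^ (-e) = 1 := fun e => by
    rw [← Real.rpow_add hT0, add_neg_cancel, Real.rpow_zero]
  have hnP : (nP : ℝ) / σ ^ 2 = A ^ ((2 * β + α) / γ) := by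
    rw [hA, ← Real.rpow_mul (by positivity), div_mul_div_cancel₀ hδ.ne', div_self hγ0.ne',
      Real.rpow_one]
  have hbound : ∀ a e : ℝ, 0 ≤ a → 2 * β ≤ e → a ≤ T ^ (e / γ) →
      34 * L ^ 2 * (a * (κ * T ^ (-(1 / γ))) ^ e) ≤ 1 := by
    intro a e ha he haT
    rw [hTpow]
    calc 34 * L ^ 2 * (a * (κ ^ e * T ^ (-(e / γ))))
        ≤ 34 * L ^ 2 * (T ^ (e / γ) * (y * T ^ (-(e / γ)))) := by
          gcongr
          exact hκle e he
      _ = 34 * L ^ 2 * y * (T ^ (e / γ) * T ^ (-(e / γ))) := by ring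
      _ ≤ 1 := by rw [hTinv, mul_one]; exact hyL
  refine ⟨κ * T ^ (-(1 / γ)), by positivity, hr16, hrs, ?_, ?_, ?_⟩
  · rw [hTpow, hκy]
  · refine hbound _ _ (by positivity) (by linarith) ?_
    rw [hnP]
    exact Real.rpow_le_rpow hA0 (by linarith) (by positivity)
  · refine hbound _ _ hB0 hγ ?_
    rw [div_self hγ0.ne', Real.rpow_one]
    linarith

theorem rpow_sq_eq {r : ℝ} (hr : 0 < r) (L β : ℝ) :
    (L * r ^ β) ^ 2 = L ^ 2 * r ^ (2 * β) := by
  rw [mul_pow, ← Real.rpow_mul_natCast hr.le, mul_comm β]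
  norm_num

theorem le_minimaxRisk_of_mem {nP nQ : ℕ} {P Q : Measure unitInterval} {β L σ : ℝ} {b : ℝ≥0∞}
    (h : b ≤ minimaxRisk nP nQ P Q β L {gaussianNoise σ}) {N : Set (Kernel unitInterval ℝ)}
    (hN : N ∈ ({noiseClass σ, {gaussianNoise σ}} : Set (Set (Kernel unitInterval ℝ)))) :
    b ≤ minimaxRisk nP nQ P Q β L N := by
  rcases hN with rfl | hN
  · exact h.trans (minimaxRisk_mono nP nQ P Q β L
      (Set.singleton_subset_iff.2 (gaussianNoise_mem_noiseClass σ)))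
  · rw [Set.mem_singleton_iff.1 hN]
    exact h

theorem exists_alphaFamily_le_minimaxRisk {β L α C : ℝ} (hβ0 : 0 < β) (hβ1 : β ≤ 1) (hL : 0 < L)
    (hα : 1 < α) (hC : 1 ≤ C) :
    ∃ c : ℝ, 0 < c ∧ ∀ σ : ℝ, 0 < σ → ∃ n₀ : ℕ, ∀ nP nQ : ℕ, n₀ ≤ max nP nQ →
      ∃ P Q : ProbabilityMeasure unitInterval, (P, Q) ∈ alphaFamily α C ∧
        ENNReal.ofReal (c * (((nP : ℝ) / σ ^ 2) ^ ((2 * β + 1) / (2 * β + α))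
              + (nQ : ℝ) / σ ^ 2) ^ (-(2 * β / (2 * β + 1))))
          ≤ minimaxRisk nP nQ (P : Measure unitInterval) Q β L {gaussianNoise σ} := by
  obtain ⟨y, hy, H⟩ := exists_bandwidth (γ := 2 * β + 1) hβ0 (by linarith : 0 < α) (by linarith) hL
  refine ⟨L ^ 2 * y / 8, by positivity, fun σ hσ => ?_⟩
  obtain ⟨n₀, hn₀⟩ := H σ hσ
  refine ⟨n₀, fun nP nQ hn => ?_⟩
  obtain ⟨r, hr, hr16, hrσ, hry, hP, hQ⟩ := hn₀ nP nQ hn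
  -- The largest M with 8Mr ≤ 1. As r ≤ 1/16, rounding down costs at most a factor 2, whence 1/M ≤
  -- 16 r.
  set M := ⌊1 / (8 * r)⌋₊ with hMdef
  have hx : 2 ≤ 1 / (8 * r) := by rw [le_div_iff₀ (by positivity)]; linarith
  have hMle : (M : ℝ) ≤ 1 / (8 * r) := Nat.floor_le (by positivity)
  have hMlt : 1 / (8 * r) < M + 1 := Nat.lt_floor_add_one _
  have hM : 0 < M := Nat.floor_pos.2 (by linarith)
  have hM' : (1 : ℝ) ≤ M := by exact_mod_cast hM
  have hMr : 8 * M * r ≤ 1 := by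
    rw [le_div_iff₀ (by positivity)] at hMle
    linarith
  have hMinv : 1 / (M : ℝ) ≤ 16 * r := by
    rw [div_lt_iff₀ (by positivity)] at hMlt
    rw [div_le_iff₀ (by positivity)]
    nlinarith
  have hrα : r ^ α ≤ r := by
    simpa using Real.rpow_le_rpow_of_exponent_ge hr (by linarith) hα.le
  have hp1 : M * r ^ α ≤ 1 := by
    have : M * r ^ α ≤ M * r := by gcongr
    nlinarith
  refine ⟨⟨cellLaw r M (M * r ^ α), isProbabilityMeasure_cellLaw r hM (by positivity) hp1⟩,
    ⟨cellLaw r M 1, isProbabilityMeasure_cellLaw r hM zero_le_one le_rfl⟩,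
    iSup_similarity_many_cells_le hα hC hr hM hMr, ?_⟩
  have hrisk := le_minimaxRisk_cellLaw (nP := nP) (nQ := nQ) hβ0 hβ1 hL hσ hr hM
    (by linarith) (by positivity : 0 ≤ M * r ^ α) hp1
    (by rw [rpow_sq_eq hr]; exact hrσ) (by
      rw [rpow_sq_eq hr, mul_div_cancel_left₀ _ (by positivity)]
      rw [Real.rpow_add hr] at hP hQ
      rw [Real.rpow_one] at hQ
      calc 2 * (L ^ 2 * r ^ (2 * β) / σ ^ 2) * (nP * r ^ α + nQ * (1 / M))
          ≤ 2 * (L ^ 2 * r ^ (2 * β) / σ ^ 2) * (nP * r ^ α + nQ * (16 * r)) := by gcongr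
        _ = (34 * L ^ 2 * (nP / σ ^ 2 * (r ^ (2 * β) * r ^ α))
            + 16 * (34 * L ^ 2 * (nQ / σ ^ 2 * (r ^ (2 * β) * r)))) / 17 := by ring
        _ ≤ 1 := by linarith)
  rw [rpow_sq_eq hr, hry] at hrisk
  refine le_trans (le_of_eq ?_) hrisk
  congr 1
  ring

theorem exists_restrictedAlphaFamily_le_minimaxRisk {β L α C : ℝ} (hβ0 : 0 < β) (hβ1 : β ≤ 1)
    (hL : 0 < L) (hα : 0 < α) (hC : 1 ≤ C) :
    ∃ c : ℝ, 0 < c ∧ ∀ σ : ℝ, 0 < σ → ∃ n₀ : ℕ, ∀ nP nQ : ℕ, n₀ ≤ max nP nQ →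
      ∃ P Q : ProbabilityMeasure unitInterval, (P, Q) ∈ restrictedAlphaFamily α C ∧
        ENNReal.ofReal (c * (((nP : ℝ) / σ ^ 2) ^ (2 * β / (2 * β + α)) + (nQ : ℝ) / σ ^ 2)⁻¹)
          ≤ minimaxRisk nP nQ (P : Measure unitInterval) Q β L {gaussianNoise σ} := by
  -- With a single cell the target information is nQ r^(2β)/σ² up to a constant, without the extra
  -- factor r from 1/M; hence γ = 2β instead of 2β + 1.
  obtain ⟨y, hy, H⟩ := exists_bandwidth (γ := 2 * β) hβ0 hα le_rfl hL
  refine ⟨L ^ 2 * y / 8, by positivity, fun σ hσ => ?_⟩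
  obtain ⟨n₀, hn₀⟩ := H σ hσ
  refine ⟨n₀, fun nP nQ hn => ?_⟩
  obtain ⟨r, hr, hr16, hrσ, hry, hP, hQ⟩ := hn₀ nP nQ hn
  have hr1 : r ≤ 1 := by linarith
  have hp1 : r ^ α ≤ 1 := Real.rpow_le_one hr.le hr1 hα.le
  refine ⟨⟨cellLaw r 1 (r ^ α), isProbabilityMeasure_cellLaw r one_pos (by positivity) hp1⟩,
    ⟨cellLaw r 1 1, isProbabilityMeasure_cellLaw r one_pos zero_le_one le_rfl⟩,
    ⟨iSup_similarity_one_cell_le hα hC hr hr1, iSup_similarity_self_one_cell_le hC⟩, ?_⟩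
  have hrisk := le_minimaxRisk_cellLaw (M := 1) (nP := nP) (nQ := nQ) hβ0 hβ1 hL hσ hr one_pos
    (by norm_num; linarith) (by positivity : 0 ≤ r ^ α) hp1
    (by rw [rpow_sq_eq hr]; exact hrσ) (by
      rw [rpow_sq_eq hr]
      rw [Real.rpow_add hr] at hP
      calc _ = (34 * L ^ 2 * (nP / σ ^ 2 * (r ^ (2 * β) * r ^ α))
            + 34 * L ^ 2 * (nQ / σ ^ 2 * r ^ (2 * β))) / 17 := by push_cast; ring
        _ ≤ 1 := by linarith)
  rw [rpow_sq_eq hr, hry, div_self (by positivity), Real.rpow_neg_one] at hrisk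
  refine le_trans (le_of_eq ?_) hrisk
  congr 1
  ring

end CovariateShift

theorem theorem2 (β L α C : ℝ) (hβ0 : 0 < β) (hβ1 : β ≤ 1) (hL : 0 < L) (hα : 0 < α)
    (hC : 1 ≤ C) :
    ∃ c : ℝ, 0 < c ∧ ∀ σ : ℝ, 0 < σ → ∃ n₀ : ℕ, ∀ nP nQ : ℕ, n₀ ≤ max nP nQ →
      (1 < α → ∃ P Q : ProbabilityMeasure unitInterval,
        (P, Q) ∈ CovariateShift.alphaFamily α C ∧
        ∀ N ∈ ({CovariateShift.noiseClass σ, {CovariateShift.gaussianNoise σ}} :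
            Set (Set (Kernel unitInterval ℝ))),
          ENNReal.ofReal (c * (((nP : ℝ) / σ ^ 2) ^ ((2 * β + 1) / (2 * β + α))
              + (nQ : ℝ) / σ ^ 2) ^ (-(2 * β / (2 * β + 1))))
            ≤ CovariateShift.minimaxRisk nP nQ (P : Measure unitInterval) Q β L N) ∧
      (α ≤ 1 → ∃ P Q : ProbabilityMeasure unitInterval,
        (P, Q) ∈ CovariateShift.restrictedAlphaFamily α C ∧
        ∀ N ∈ ({CovariateShift.noiseClass σ, {CovariateShift.gaussianNoise σ}} :
            Set (Set (Kernel unitInterval ℝ))),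
          ENNReal.ofReal (c * (((nP : ℝ) / σ ^ 2) ^ (2 * β / (2 * β + α))
              + (nQ : ℝ) / σ ^ 2)⁻¹)
            ≤ CovariateShift.minimaxRisk nP nQ (P : Measure unitInterval) Q β L N) := by
  -- The constant may depend on α, so it is taken from the regime that holds and the other claim is
  -- vacuous.
  rcases lt_or_ge 1 α with h1 | h1
  · obtain ⟨c, hc, H⟩ :=
      CovariateShift.exists_alphaFamily_le_minimaxRisk (C := C) hβ0 hβ1 hL h1 hC
    refine ⟨c, hc, fun σ hσ => ?_⟩
    obtain ⟨n₀, hn₀⟩ := H σ hσ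
    refine ⟨n₀, fun nP nQ hn => ⟨fun _ => ?_, fun h => absurd h (not_le.2 h1)⟩⟩
    obtain ⟨P, Q, hPQ, hrisk⟩ := hn₀ nP nQ hn
    exact ⟨P, Q, hPQ, fun N hN => CovariateShift.le_minimaxRisk_of_mem hrisk hN⟩
  · obtain ⟨c, hc, H⟩ :=
      CovariateShift.exists_restrictedAlphaFamily_le_minimaxRisk (C := C) hβ0 hβ1 hL hα hC
    refine ⟨c, hc, fun σ hσ => ?_⟩
    obtain ⟨n₀, hn₀⟩ := H σ hσ
    refine ⟨n₀, fun nP nQ hn => ⟨fun h => absurd h (not_lt.2 h1), fun _ => ?_⟩⟩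
    obtain ⟨P, Q, hPQ, hrisk⟩ := hn₀ nP nQ hn
    exact ⟨P, Q, hPQ, fun N hN => CovariateShift.le_minimaxRisk_of_mem hrisk hN⟩
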